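/- Let $\alpha>-1$, $\beta\in\mathbb R$ and $k\in\mathbb R$ with $0<k^2<1$, and let $$w(x)=(1-x^2)^{\alpha}(1-k^2x^2)^{\beta},\qquad x\in[-1,1].$$ There is a unique sequence $(P_n)_{n\ge 0}$ of real monic polynomials with $\deg P_n=n$ that are orthogonal with respect to $w$ on $[-1,1]$, i.e. $\int_{-1}^1 P_i(x)P_j(x)w(x)\,dx=0$ for $i\ne j$. Put $h_n=\int_{-1}^{1}P_n(x)^2w(x)\,dx$, $\beta_0=0$ and $\beta_n=h_n/h_{n-1}$ for $n\ge 1$, so that $xP_0(x)=P_1(x)$ and $xP_n(x)=P_{n+1}(x)+\beta_nP_{n-1}(x)$ for $n\ge 1$. Let $\mathsf p_1(n)$ be the coefficient of $x^{n-2}$ in $P_n$ for $n\ge 2$, and $\mathsf p_1(0)=\mathsf p_1(1)=0$. Then for every integer $n\ge 0$ (for $n=0$ the term containing $\beta_{-1}\beta_0$ is read as $0$) $$\begin{aligned} 0={}&k^2\,\mathsf p_1(n)^2+\Big[2k^2\big(\alpha+\beta+n-\tfrac12\big)\beta_n-\alpha k^2-\beta\Big]\mathsf p_1(n)-k^2\big(\alpha+\beta+n+\tfrac32\big)\big(\alpha+\beta+n-\tfrac12\big)\beta_n^2\\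 &-\Big[k^2\big(\alpha+\beta+n+\tfrac32\big)\big(\alpha+\beta+n-\tfrac12\big)\beta_{n+1}-\Big\{\big(\beta+n+\tfrac12\big)k^2+\big(\alpha+n+\tfrac12\big)\Big\}\big(\alpha+\beta+n-\tfrac12\big)\\ &\qquad+k^2\big(\alpha+\beta+n+\tfrac12\big)\big(\alpha+\beta+n-\tfrac32\big)\beta_{n-1}\Big]\beta_n-\frac n2\Big(\frac n2+\alpha+\beta\Big). \end{aligned}$$ -/

import Mathlib

open Polynomial

noncomputable section

/-- The weight `(1 - x²)^α (1 - k²x²)^β`, used on `[-1, 1]`. -/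
def modJacobiWeight (α β k x : ℝ) : ℝ :=
  (1 - x ^ 2) ^ α * (1 - k ^ 2 * x ^ 2) ^ β

/-- The pairing `∫_{-1}^{1} p(x) q(x) w(x) dx` of two polynomials. -/
def weightedInner (w : ℝ → ℝ) (p q : ℝ[X]) : ℝ :=
  ∫ x in (-1 : ℝ)..1, p.eval x * q.eval x * w x

/-- `P 0, P 1, P 2, …` is a sequence of monic polynomials, `P n` of degree `n`, orthogonal
with respect to the weight `w` on `[-1, 1]`. -/
structure IsMonicOrthogonalSeq (w : ℝ → ℝ) (P : ℕ → ℝ[X]) : Prop where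
  monic : ∀ n, (P n).Monic
  natDegree_eq : ∀ n, (P n).natDegree = n
  orthogonal : ∀ i j, i ≠ j → weightedInner w (P i) (P j) = 0

/-- `h_n = ∫_{-1}^{1} P_n(x)² w(x) dx`. -/
def sqNorm (w : ℝ → ℝ) (P : ℕ → ℝ[X]) (n : ℕ) : ℝ :=
  weightedInner w (P n) (P n)

/-- The recurrence coefficient: `β_0 = 0` and `β_n = h_n / h_{n-1}` for `n ≥ 1`. -/
def recCoeff (w : ℝ → ℝ) (P : ℕ → ℝ[X]) : ℕ → ℝ
  | 0 => 0
  | n + 1 => sqNorm w P (n + 1) / sqNorm w P n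

/-- The coefficient `p₁(n)` of `x^(n-2)` in `P_n`, with `p₁(0) = p₁(1) = 0`. -/
def subleadingCoeff (P : ℕ → ℝ[X]) : ℕ → ℝ
  | 0 => 0
  | 1 => 0
  | n + 2 => (P (n + 2)).coeff n

end

/-! Let `σ = (1 - x²)(1 - k²x²)`. Since `α > -1`, `σ w` vanishes at `±1`, and `(σ w)' = τ w` with
`τ` odd of degree at most 3. Integration by parts then gives `L (σ f' + τ f) = 0` for `L f = ∫ f w`
(`modJacobiWeight_pearson`).

The rest is algebra of an even positive definite `L`. Differentiating `x P_n = P_{n+1} + b_n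
P_{n-1}`, multiplying by `σ P_n` and applying `L` leaves moments computable from leading
coefficients and from the Pearson identity. This is `laguerre_freud`, a relation `F_n = 0` in `b`
and `p₁`.

Writing the claimed identity as `0 = E_n`, the factor `(α + β + n + 1/2) / 2` makes `F_n` exact:
`E_{n+1} - E_n = -((α + β + n + 1/2) / 2) F_n`. As `E_0 = 0`, every `E_n` vanishes
(`difference_equation_of_laguerre_freud`). -/

/-- A linear functional on real polynomials that is even and positive definite. -/
structure IsEvenPosDef (L : ℝ[X] →ₗ[ℝ] ℝ) : Prop where
  pos : ∀ p, p ≠ 0 → 0 < L (p * p)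
  even : ∀ p, L (p.comp (-X)) = L p

/-- Monic orthogonal polynomials with respect to a linear functional. -/
structure IsMonicOrthogonal (L : ℝ[X] →ₗ[ℝ] ℝ) (P : ℕ → ℝ[X]) : Prop where
  monic : ∀ n, (P n).Monic
  natDegree_eq : ∀ n, (P n).natDegree = n
  orthogonal : ∀ i j, i ≠ j → L (P i * P j) = 0

/-! ### Orthogonal polynomials of an even functional: existence, uniqueness, parity. -/

theorem IsEvenPosDef.eq_zero {L : ℝ[X] →ₗ[ℝ] ℝ} (hL : IsEvenPosDef L) {p : ℝ[X]}
    (h : L (p * p) = 0) : p = 0 := by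
  by_contra hp
  exact (hL.pos p hp).ne' h

/-- Positive definiteness makes the Gram map from `degreeLT ℝ n` to its dual injective, hence
surjective by dimension; `r` is a preimage of `q ↦ L (f * q)`. -/
theorem IsEvenPosDef.exists_orthogonal_projection {L : ℝ[X] →ₗ[ℝ] ℝ} (hL : IsEvenPosDef L)
    (n : ℕ) (f : ℝ[X]) :
    ∃ r : ℝ[X], r.degree < n ∧ ∀ q : ℝ[X], q.degree < n → L ((f - r) * q) = 0 := by
  let V := degreeLT ℝ n
  have : FiniteDimensional ℝ V := Module.Finite.equiv (degreeLTEquiv ℝ n).symm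
  let M (g : ℝ[X]) : Module.Dual ℝ V := L ∘ₗ LinearMap.mulLeft ℝ g ∘ₗ V.subtype
  let B : V →ₗ[ℝ] Module.Dual ℝ V :=
    { toFun := fun r => M r
      map_add' := fun a b => by ext q; simp [M, add_mul]
      map_smul' := fun c a => by ext q; simp [M] }
  have hinj : Function.Injective B := by
    rw [← LinearMap.ker_eq_bot, LinearMap.ker_eq_bot']
    intro r hr
    exact Subtype.ext (hL.eq_zero (LinearMap.congr_fun hr r))
  obtain ⟨r, hr⟩ := (LinearMap.injective_iff_surjective_of_finrank_eq_finrank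
    (Subspace.dual_finrank_eq (K := ℝ) (V := V)).symm).1 hinj (M f)
  refine ⟨r, mem_degreeLT.1 r.2, fun q hq => ?_⟩
  have h := LinearMap.congr_fun hr ⟨q, mem_degreeLT.2 hq⟩
  have h' : L (r * q) = L (f * q) := h
  rw [sub_mul, map_sub, h', sub_self]

namespace IsMonicOrthogonal

variable {L : ℝ[X] →ₗ[ℝ] ℝ} {P : ℕ → ℝ[X]}

theorem degree_eq (hP : IsMonicOrthogonal L P) (n : ℕ) : (P n).degree = n := by
  rw [degree_eq_natDegree (hP.monic n).ne_zero, hP.natDegree_eq]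

theorem coeff_self (hP : IsMonicOrthogonal L P) (n : ℕ) : (P n).coeff n = 1 := by
  have h := hP.monic n
  rwa [Monic, leadingCoeff, hP.natDegree_eq] at h

theorem coeff_eq_zero (hP : IsMonicOrthogonal L P) {n m : ℕ} (h : n < m) :
    (P n).coeff m = 0 :=
  coeff_eq_zero_of_natDegree_lt (by rwa [hP.natDegree_eq])

theorem degree_sub_lt (hP : IsMonicOrthogonal L P) {d : ℕ} {q : ℝ[X]}
    (hq : q.degree < (d + 1 : ℕ)) : (q - C (q.coeff d) * P d).degree < d := by
  rw [degree_lt_iff_coeff_zero] at hq ⊢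
  intro m hm
  rw [coeff_sub, coeff_C_mul]
  rcases hm.eq_or_lt with rfl | hm
  · rw [hP.coeff_self]; ring
  · rw [hP.coeff_eq_zero hm, hq m hm]; ring

/-- Used with `S` the kernel of `q ↦ L (g * q)`: orthogonality to each `P j` extends to all lower
degrees. -/
theorem mem_of_degree_lt (hP : IsMonicOrthogonal L P) (S : Submodule ℝ ℝ[X]) (d : ℕ)
    (hS : ∀ j < d, P j ∈ S) (q : ℝ[X]) (hq : q.degree < d) : q ∈ S := by
  induction d generalizing q with
  | zero =>
    have : q = 0 := by simpa [Nat.WithBot.lt_zero_iff] using hq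
    exact this ▸ S.zero_mem
  | succ d ih =>
    have h := ih (fun j hj => hS j (by omega)) _ (hP.degree_sub_lt hq)
    have h2 := S.smul_mem (q.coeff d) (hS d (by omega))
    rw [smul_eq_C_mul] at h2
    simpa using S.add_mem h h2

theorem apply_mul_eq_zero (hP : IsMonicOrthogonal L P) {n : ℕ} {q : ℝ[X]} (hq : q.degree < n) :
    L (P n * q) = 0 :=
  hP.mem_of_degree_lt (LinearMap.ker (L ∘ₗ LinearMap.mulLeft ℝ (P n))) n
    (fun j hj => hP.orthogonal n j hj.ne') q hq

theorem eq_of_monic (hL : IsEvenPosDef L) (hP : IsMonicOrthogonal L P) {n : ℕ} {p : ℝ[X]}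
    (hm : p.Monic) (hd : p.natDegree = n) (ho : ∀ q : ℝ[X], q.degree < n → L (p * q) = 0) :
    p = P n := by
  have hdeg : (p - P n).degree < n := by
    rw [degree_lt_iff_coeff_zero]
    intro m hmn
    rw [coeff_sub]
    rcases hmn.eq_or_lt with rfl | hmn
    · rw [hP.coeff_self, ← hd, hm.coeff_natDegree, sub_self]
    · rw [hP.coeff_eq_zero hmn, coeff_eq_zero_of_natDegree_lt (by omega), sub_self]
  refine sub_eq_zero.1 (hL.eq_zero ?_)
  rw [sub_mul, map_sub, ho _ hdeg, hP.apply_mul_eq_zero hdeg, sub_self]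

theorem unique (hL : IsEvenPosDef L) {Q : ℕ → ℝ[X]} (hP : IsMonicOrthogonal L P)
    (hQ : IsMonicOrthogonal L Q) : Q = P :=
  funext fun n => hP.eq_of_monic hL (hQ.monic n) (hQ.natDegree_eq n)
    fun _ hq => hQ.apply_mul_eq_zero hq

/-- By evenness of `L`, `(-1)^n P_n(-x)` is again monic and orthogonal to lower degrees, so
uniqueness applies. -/
theorem comp_neg_X (hL : IsEvenPosDef L) (hP : IsMonicOrthogonal L P) (n : ℕ) :
    (P n).comp (-X) = (-1) ^ n * P n := by
  have hQ : (-1) ^ n * (P n).comp (-X) = P n := by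
    refine hP.eq_of_monic hL ?_ ?_ fun q hq => ?_
    · have := (hP.monic n).neg_one_pow_natDegree_mul_comp_neg_X
      rwa [hP.natDegree_eq] at this
    · have : ((-1 : ℝ[X]) ^ n) = C ((-1) ^ n) := by simp
      rw [this, natDegree_C_mul (by simp), natDegree_comp, hP.natDegree_eq]
      simp
    · have h1 : ((-1 : ℝ[X]) ^ n) = C ((-1) ^ n) := by simp
      have h2 : (P n).comp (-X) * q = (P n * q.comp (-X)).comp (-X) := by
        rw [mul_comp, comp_neg_X_comp_neg_X]
      rw [h1, mul_assoc, ← smul_eq_C_mul, map_smul, h2, hL.even,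
        hP.apply_mul_eq_zero (by rwa [degree_comp_neg_X]), smul_zero]
  conv_rhs => rw [← hQ]
  rw [← mul_assoc, ← mul_pow]
  simp

theorem apply_X_mul_self (hL : IsEvenPosDef L) (hP : IsMonicOrthogonal L P) (n : ℕ) :
    L (X * P n * P n) = 0 := by
  have h := hL.even (X * P n * P n)
  have h2 : (X * P n * P n).comp (-X) = -(X * P n * P n) := by
    rw [mul_comp, mul_comp, hP.comp_neg_X hL, X_comp]
    have : ((-1 : ℝ[X]) ^ n) * (-1) ^ n = 1 := by rw [← mul_pow]; simp
    linear_combination (-X * P n * P n) * this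
  rw [h2, map_neg] at h
  linarith

theorem pos (hL : IsEvenPosDef L) (hP : IsMonicOrthogonal L P) (n : ℕ) : 0 < L (P n * P n) :=
  hL.pos _ (hP.monic n).ne_zero

end IsMonicOrthogonal

theorem IsEvenPosDef.exists_isMonicOrthogonal {L : ℝ[X] →ₗ[ℝ] ℝ} (hL : IsEvenPosDef L) :
    ∃ P, IsMonicOrthogonal L P := by
  choose r hr ho using fun n => hL.exists_orthogonal_projection n (X ^ n)
  have hd (n : ℕ) : (X ^ n - r n).natDegree = n := by
    refine natDegree_eq_of_degree_eq_some ?_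
    rw [degree_sub_eq_left_of_degree_lt (by rw [degree_X_pow]; exact hr n), degree_X_pow]
  have hlt (i j : ℕ) (hij : i < j) : L ((X ^ j - r j) * (X ^ i - r i)) = 0 := by
    refine ho j _ ?_
    rw [degree_lt_iff_coeff_zero]
    intro m hm
    exact coeff_eq_zero_of_natDegree_lt (by rw [hd]; omega)
  refine ⟨fun n => X ^ n - r n, fun n => monic_X_pow_sub (hr n), hd, fun i j hij => ?_⟩
  rcases hij.lt_or_gt with h | h
  · rw [mul_comm]; exact hlt i j h
  · exact hlt j i h

/-! ### Three-term recurrence. -/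

namespace IsMonicOrthogonal

variable {L : ℝ[X] →ₗ[ℝ] ℝ} {P : ℕ → ℝ[X]} {b : ℕ → ℝ}

theorem apply_C_mul (L : ℝ[X] →ₗ[ℝ] ℝ) (c : ℝ) (p : ℝ[X]) : L (C c * p) = c * L p := by
  rw [← smul_eq_C_mul, map_smul, smul_eq_mul]

/-- The three-term recurrence of an even functional, with `b 0 = 0`. -/
theorem X_mul (hL : IsEvenPosDef L) (hP : IsMonicOrthogonal L P) (hb0 : b 0 = 0)
    (hb : ∀ n, L (P (n + 1) * P (n + 1)) = b (n + 1) * L (P n * P n)) (n : ℕ) :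
    X * P n = P (n + 1) + C (b n) * P (n - 1) := by
  -- The defect `r` has degree at most `n` and is orthogonal to every `P j` with `j ≤ n`, hence to
  -- itself.
  set r := X * P n - P (n + 1) - C (b n) * P (n - 1) with hr
  have hdeg : r.degree < ((n + 1 : ℕ) : WithBot ℕ) := by
    rw [degree_lt_iff_coeff_zero]
    intro m hm
    obtain ⟨m, rfl⟩ := Nat.exists_eq_add_of_le' (by omega : 1 ≤ m)
    rw [hr, coeff_sub, coeff_sub, coeff_X_mul, coeff_C_mul,
      hP.coeff_eq_zero (by omega : n - 1 < m + 1)]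
    rcases (by omega : n ≤ m).eq_or_lt with rfl | h
    · rw [hP.coeff_self, hP.coeff_self]; ring
    · rw [hP.coeff_eq_zero h, hP.coeff_eq_zero (by omega)]; ring
  have horth : r ∈ LinearMap.ker (L ∘ₗ LinearMap.mulLeft ℝ r) := by
    refine hP.mem_of_degree_lt _ (n + 1) (fun j hj => ?_) r hdeg
    change L (r * P j) = 0
    have e : r * P j = X * P n * P j - P (n + 1) * P j - C (b n) * (P (n - 1) * P j) := by
      rw [hr]; ring
    rw [e, map_sub, map_sub, apply_C_mul, hP.orthogonal (n + 1) j (by omega)]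
    rcases (by omega : j ≤ n).eq_or_lt with rfl | h
    · rw [hP.apply_X_mul_self hL]
      cases j with
      | zero => rw [hb0]; ring
      | succ j => rw [hP.orthogonal _ _ (by omega)]; ring
    obtain ⟨n, rfl⟩ := Nat.exists_eq_add_of_le' (by omega : 1 ≤ n)
    rw [Nat.add_sub_cancel]
    rcases (by omega : j ≤ n).eq_or_lt with rfl | h
    · have hd : (X * P j - P (j + 1)).degree < ((j + 1 : ℕ) : WithBot ℕ) := by
        rw [degree_lt_iff_coeff_zero]
        intro m hm
        obtain ⟨m, rfl⟩ := Nat.exists_eq_add_of_le' (by omega : 1 ≤ m)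
        rw [coeff_sub, coeff_X_mul]
        rcases (by omega : j ≤ m).eq_or_lt with rfl | h
        · rw [hP.coeff_self, hP.coeff_self, sub_self]
        · rw [hP.coeff_eq_zero h, hP.coeff_eq_zero (by omega), sub_self]
      have e : X * P (j + 1) * P j = P (j + 1) * (X * P j - P (j + 1)) + P (j + 1) * P (j + 1) := by
        ring
      rw [e, map_add, hP.apply_mul_eq_zero hd, hb]
      ring
    · have hd : (X * P j).degree < ((n + 1 : ℕ) : WithBot ℕ) := by
        rw [degree_mul, degree_X, hP.degree_eq]
        exact_mod_cast (by omega : 1 + j < n + 1)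
      rw [mul_assoc, mul_left_comm, hP.apply_mul_eq_zero hd, hP.orthogonal _ _ (by omega)]
      ring
  linear_combination hL.eq_zero horth

end IsMonicOrthogonal

/-! ### Moments and the Laguerre–Freud equation. -/

section Recurrence

variable {L : ℝ[X] →ₗ[ℝ] ℝ} {P : ℕ → ℝ[X]} {b : ℕ → ℝ}

/-- Monic orthogonal polynomials together with the coefficients of their recurrence
`x P_n = P_{n+1} + b_n P_{n-1}`. -/
structure IsSymmRecurrence (L : ℝ[X] →ₗ[ℝ] ℝ) (P : ℕ → ℝ[X]) (b : ℕ → ℝ) : Prop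
    extends IsMonicOrthogonal L P where
  zero : b 0 = 0
  sqNorm_succ : ∀ n, L (P (n + 1) * P (n + 1)) = b (n + 1) * L (P n * P n)
  X_mul : ∀ n, X * P n = P (n + 1) + C (b n) * P (n - 1)

namespace IsSymmRecurrence

open IsMonicOrthogonal

theorem coeff_succ (h : IsSymmRecurrence L P b) (n : ℕ) : (P (n + 1)).coeff n = 0 := by
  have key (n m : ℕ) : (X * P n).coeff m = (P (n + 1)).coeff m + b n * (P (n - 1)).coeff m := by
    rw [h.X_mul, coeff_add, coeff_C_mul]
  induction n with
  | zero => simpa [h.zero] using (key 0 0).symm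
  | succ n ih =>
    have := key (n + 1) (n + 1)
    rw [coeff_X_mul, ih, h.coeff_eq_zero (by omega : n + 1 - 1 < n + 1)] at this
    linarith

theorem subleadingCoeff_eq (h : IsSymmRecurrence L P b) {n : ℕ} (hn : 1 ≤ n) :
    (P (n + 1)).coeff (n - 1) = subleadingCoeff P n - b n := by
  obtain ⟨n, rfl⟩ := Nat.exists_eq_add_of_le' hn
  have := congrArg (coeff · n) (h.X_mul (n + 1))
  simp only [coeff_add, coeff_C_mul, Nat.add_sub_cancel, h.coeff_self] at this
  rw [Nat.add_sub_cancel]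
  cases n with
  | zero =>
    simp only [subleadingCoeff]
    simp at this
    linarith
  | succ n =>
    rw [coeff_X_mul] at this
    simp only [subleadingCoeff]
    linarith

theorem subleadingCoeff_succ (h : IsSymmRecurrence L P b) (n : ℕ) :
    subleadingCoeff P (n + 1) = subleadingCoeff P n - b n := by
  cases n with
  | zero => simp [subleadingCoeff, h.zero]
  | succ n => exact h.subleadingCoeff_eq (by omega : 1 ≤ n + 1)

theorem X_sq_mul (h : IsSymmRecurrence L P b) (n : ℕ) :
    X ^ 2 * P n = P (n + 2) + C (b (n + 1) + b n) * P n + C (b n * b (n - 1)) * P (n - 2) := by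
  have h1 := h.X_mul n
  have h2 := h.X_mul (n + 1)
  cases n with
  | zero =>
    simp only [h.zero, C_0, zero_mul, add_zero, Nat.zero_add] at h1 h2 ⊢
    rw [Nat.sub_self] at h2
    linear_combination X * h1 + h2
  | succ n =>
    have h3 := h.X_mul n
    rw [Nat.add_sub_cancel] at *
    have e : n + 1 - 2 = n - 1 := by omega
    rw [e, C_add, C_mul]
    linear_combination X * h1 + h2 + C (b (n + 1)) * h3

theorem apply_X_mul (h : IsSymmRecurrence L P b) (n : ℕ) :
    L (X * P n * P (n + 1)) = b (n + 1) * L (P n * P n) := by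
  rw [h.X_mul, add_mul, mul_assoc, map_add, apply_C_mul, h.orthogonal (n - 1) _ (by omega),
    h.sqNorm_succ]
  ring

theorem apply_X_sq_mul (h : IsSymmRecurrence L P b) (n : ℕ) :
    L (X ^ 2 * P n * P n) = (b n + b (n + 1)) * L (P n * P n) := by
  rw [h.X_sq_mul, add_mul, add_mul, mul_assoc, mul_assoc, map_add, map_add, apply_C_mul,
    apply_C_mul, h.orthogonal (n + 2) n (by omega)]
  cases n with
  | zero => rw [h.zero]; ring
  | succ n => rw [h.orthogonal (n + 1 - 2) _ (by omega)]; ring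

theorem apply_X_pow_three_mul (h : IsSymmRecurrence L P b) (n : ℕ) :
    L (X ^ 3 * P n * P (n + 1)) =
      b (n + 1) * (b n + b (n + 1) + b (n + 2)) * L (P n * P n) := by
  have e : X ^ 3 * P n * P (n + 1) = P (n + 2) * P (n + 2) + C (b (n + 1)) * (P (n + 2) * P n)
      + C (b (n + 1) + b n) * (P n * P (n + 2))
      + C ((b (n + 1) + b n) * b (n + 1)) * (P n * P n)
      + C (b n * b (n - 1)) * (P (n - 2) * P (n + 2))
      + C (b n * b (n - 1) * b (n + 1)) * (P (n - 2) * P n) := by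
    have h1 := h.X_mul (n + 1)
    rw [Nat.add_sub_cancel] at h1
    calc X ^ 3 * P n * P (n + 1) = (X ^ 2 * P n) * (X * P (n + 1)) := by ring
      _ = _ := by rw [h.X_sq_mul, h1]; simp only [C_mul, C_add]; ring
  rw [e]
  simp only [map_add L, apply_C_mul]
  rw [h.orthogonal (n + 2) n (by omega), h.orthogonal n (n + 2) (by omega),
    h.orthogonal (n - 2) (n + 2) (by omega), h.sqNorm_succ, h.sqNorm_succ]
  cases n with
  | zero => rw [h.zero]; ring
  | succ n => rw [h.orthogonal (n + 1 - 2) _ (by omega)]; ring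

theorem apply_X_pow_four_mul (h : IsSymmRecurrence L P b) (n : ℕ) :
    L (X ^ 4 * P n * P n) =
      (b n * b (n - 1) + (b n + b (n + 1)) ^ 2 + b (n + 1) * b (n + 2)) * L (P n * P n) := by
  have e : X ^ 4 * P n * P n = P (n + 2) * P (n + 2)
      + C (2 * (b (n + 1) + b n)) * (P n * P (n + 2))
      + C ((b (n + 1) + b n) ^ 2) * (P n * P n)
      + C (2 * (b n * b (n - 1))) * (P (n - 2) * P (n + 2))
      + C (2 * (b n * b (n - 1)) * (b (n + 1) + b n)) * (P (n - 2) * P n)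
      + C ((b n * b (n - 1)) ^ 2) * (P (n - 2) * P (n - 2)) := by
    calc X ^ 4 * P n * P n = (X ^ 2 * P n) * (X ^ 2 * P n) := by ring
      _ = _ := by rw [h.X_sq_mul]; simp only [C_mul, C_add, C_pow, C_ofNat]; ring
  rw [e]
  simp only [map_add L, apply_C_mul]
  rw [h.orthogonal n (n + 2) (by omega),
    h.orthogonal (n - 2) (n + 2) (by omega), h.sqNorm_succ (n + 1), h.sqNorm_succ n]
  -- For `n ≤ 1` the truncated index `n - 2` is harmless, since `b n * b (n - 1) = 0`.
  match n with
  | 0 => rw [h.zero]; ring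
  | 1 =>
    rw [Nat.sub_self, h.zero]; ring
  | n + 2 =>
    rw [h.orthogonal (n + 2 - 2) _ (by omega), Nat.add_sub_cancel,
      show n + 2 - 1 = n + 1 by omega, h.sqNorm_succ (n + 1), h.sqNorm_succ n]
    ring

/-- `L (q P_m)` in terms of the leading coefficients of `q`. -/
theorem apply_mul_of_degree_lt (h : IsSymmRecurrence L P b) {m : ℕ} {q : ℝ[X]}
    (hq : q.degree < (m + 3 : ℕ)) (hq1 : q.coeff (m + 1) = 0) :
    L (q * P m) = (q.coeff m - q.coeff (m + 2) * (P (m + 2)).coeff m) * L (P m * P m) := by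
  set r := q - C (q.coeff (m + 2)) * P (m + 2) with hr
  have hr2 : r.degree < (m + 2 : ℕ) := h.degree_sub_lt hq
  have hr1 : r.coeff (m + 1) = 0 := by rw [hr, coeff_sub, coeff_C_mul, h.coeff_succ, hq1]; ring
  have hr0 := h.degree_sub_lt hr2
  rw [hr1, C_0, zero_mul, sub_zero] at hr0
  have hs := h.apply_mul_eq_zero (h.degree_sub_lt hr0)
  have e : q * P m = P m * (r - C (r.coeff m) * P m) + C (q.coeff (m + 2)) * (P (m + 2) * P m)
      + C (r.coeff m) * (P m * P m) := by rw [hr]; ring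
  rw [e, map_add, map_add, hs, apply_C_mul, apply_C_mul, h.orthogonal _ _ (by omega)]
  rw [hr, coeff_sub, coeff_C_mul]
  ring

/-- `σ P_n'` has degree at most `n + 3` and no `x^(n+2)` term. Removing `κ n P_{n+3}` leaves its
`P_{n+1}` component as the next coefficient. -/
theorem apply_mul_derivative_mul (h : IsSymmRecurrence L P b) (a κ : ℝ) (n : ℕ) :
    L ((1 + C a * X ^ 2 + C κ * X ^ 4) * derivative (P n) * P (n + 1)) =
      (κ * (n - 2) * subleadingCoeff P n + a * n - κ * n * subleadingCoeff P (n + 3)) *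
        L (P (n + 1) * P (n + 1)) := by
  have hz (m : ℕ) (hm : n ≤ m) : (derivative (P n)).coeff m = 0 := by
    rw [coeff_derivative, h.coeff_eq_zero (by omega), zero_mul]
  have hc (m : ℕ) : ((1 + C a * X ^ 2 + C κ * X ^ 4) * derivative (P n)).coeff m =
      (derivative (P n)).coeff m
      + a * (if 2 ≤ m then (derivative (P n)).coeff (m - 2) else 0)
      + κ * (if 4 ≤ m then (derivative (P n)).coeff (m - 4) else 0) := by
    rw [add_mul, add_mul, one_mul, mul_assoc, mul_assoc, coeff_add, coeff_add, coeff_C_mul,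
      coeff_C_mul, coeff_X_pow_mul', coeff_X_pow_mul']
  have hdeg : ((1 + C a * X ^ 2 + C κ * X ^ 4) * derivative (P n)).degree
      < ((n + 1 + 3 : ℕ) : WithBot ℕ) := by
    rw [degree_lt_iff_coeff_zero]
    intro m hm
    rw [hc, hz m (by omega), hz (m - 2) (by omega), hz (m - 4) (by omega)]
    simp
  have h2 : ((1 + C a * X ^ 2 + C κ * X ^ 4) * derivative (P n)).coeff (n + 1 + 1) = 0 := by
    rw [hc, hz _ (by omega), hz (n + 1 + 1 - 2) (by omega)]
    match n with
    | 0 | 1 => simp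
    | n + 2 =>
      rw [show n + 2 + 1 + 1 - 4 = n by omega, coeff_derivative, h.coeff_succ]
      simp
  have h3 : ((1 + C a * X ^ 2 + C κ * X ^ 4) * derivative (P n)).coeff (n + 1 + 2) = κ * n := by
    rw [hc, hz _ (by omega), hz (n + 1 + 2 - 2) (by omega)]
    match n with
    | 0 => simp
    | n + 1 =>
      rw [show n + 1 + 1 + 2 - 4 = n by omega, coeff_derivative, h.coeff_self]
      simp
  have h1 : ((1 + C a * X ^ 2 + C κ * X ^ 4) * derivative (P n)).coeff (n + 1) =
      κ * (n - 2) * subleadingCoeff P n + a * n := by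
    rw [hc, hz _ (by omega)]
    match n with
    | 0 => simp [subleadingCoeff]
    | 1 => simp [subleadingCoeff, coeff_derivative, h.coeff_self]
    | 2 => simp [coeff_derivative, h.coeff_self]; norm_num
    | n + 3 =>
      rw [if_pos (by omega), if_pos (by omega), show n + 3 + 1 - 2 = n + 2 by omega,
        show n + 3 + 1 - 4 = n by omega, coeff_derivative, coeff_derivative, h.coeff_self]
      simp only [subleadingCoeff]
      push_cast
      ring
  rw [h.apply_mul_of_degree_lt hdeg h2, h1, h3]
  rfl

/-- The Laguerre–Freud equation of a symmetric functional satisfying the Pearson equation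
`L (σ f' + τ f) = 0` with `σ = 1 + a x² + κ x⁴` and `τ = t x + u x³`. -/
theorem laguerre_freud (h : IsSymmRecurrence L P b) (hpos : ∀ n, L (P n * P n) ≠ 0)
    {a κ t u : ℝ}
    (hpear : ∀ f : ℝ[X], L ((1 + C a * X ^ 2 + C κ * X ^ 4) * derivative f
      + (C t * X + C u * X ^ 3) * f) = 0)
    {c T : ℕ → ℝ}
    (hc : ∀ n, c n = κ * (n - 2) * subleadingCoeff P n + a * n - κ * n * subleadingCoeff P (n + 3))
    (hT : ∀ n, T n = t + u * (b n + b (n + 1) + b (n + 2))) (n : ℕ) :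
    1 + a * (b n + b (n + 1))
        + κ * (b n * b (n - 1) + (b n + b (n + 1)) ^ 2 + b (n + 1) * b (n + 2))
      + b (n + 1) * (2 * c n + T n) - b n * (2 * c (n - 1) + T (n - 1)) = 0 := by
  set σ : ℝ[X] := 1 + C a * X ^ 2 + C κ * X ^ 4 with hσ
  have hA (n : ℕ) : L (σ * derivative (P n) * P (n + 1)) = c n * b (n + 1) * L (P n * P n) := by
    rw [hσ, h.apply_mul_derivative_mul, h.sqNorm_succ, hc]
    ring
  -- The Pearson identity for `f = P_n P_{n+1}` trades the derivative of `P_{n+1}` for that of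
  -- `P_n`.
  have hD (n : ℕ) : L (σ * derivative (P (n + 1)) * P n) =
      -(c n + T n) * b (n + 1) * L (P n * P n) := by
    have h1 := hpear (P n * P (n + 1))
    have e : σ * derivative (P n * P (n + 1)) + (C t * X + C u * X ^ 3) * (P n * P (n + 1)) =
        σ * derivative (P n) * P (n + 1) + σ * derivative (P (n + 1)) * P n
        + C t * (X * P n * P (n + 1)) + C u * (X ^ 3 * P n * P (n + 1)) := by
      rw [derivative_mul]; ring
    rw [e, map_add, map_add, map_add, apply_C_mul, apply_C_mul, hA, h.apply_X_mul,
      h.apply_X_pow_three_mul] at h1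
    rw [hT]
    linear_combination h1
  have hS : L (σ * P n * P n) = (1 + a * (b n + b (n + 1))
      + κ * (b n * b (n - 1) + (b n + b (n + 1)) ^ 2 + b (n + 1) * b (n + 2)))
      * L (P n * P n) := by
    have e : σ * P n * P n = P n * P n + C a * (X ^ 2 * P n * P n) + C κ * (X ^ 4 * P n * P n) := by
      rw [hσ]; ring
    rw [e, map_add, map_add, apply_C_mul, apply_C_mul, h.apply_X_sq_mul, h.apply_X_pow_four_mul]
    ring
  have hr := h.X_mul n
  have hr' := congrArg derivative hr
  simp only [derivative_add, derivative_mul, derivative_X, derivative_C, one_mul, zero_mul,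
    zero_add] at hr'
  -- Subtracting `σ P_n'` times the recurrence cancels the terms `x P_n P_n'`.
  have e : σ * P n * P n + σ * derivative (P n) * P (n + 1)
      + C (b n) * (σ * derivative (P n) * P (n - 1)) =
      σ * derivative (P (n + 1)) * P n + C (b n) * (σ * derivative (P (n - 1)) * P n) := by
    linear_combination (σ * P n) * hr' - σ * derivative (P n) * hr
  have hLe := congrArg L e
  simp only [map_add, apply_C_mul] at hLe
  rw [hS, hA, hD] at hLe
  refine mul_right_cancel₀ (hpos n) ?_
  cases n with
  | zero =>
    rw [h.zero] at hLe ⊢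
    linear_combination hLe
  | succ n =>
    rw [Nat.add_sub_cancel] at hLe ⊢
    rw [hD, hA, h.sqNorm_succ n] at hLe
    rw [h.sqNorm_succ n]
    linear_combination hLe

end IsSymmRecurrence

end Recurrence

/-! ### Summation of the Laguerre–Freud equation. -/

/-- The second-order difference equation, by summation of the Laguerre–Freud equation. -/
theorem difference_equation_of_laguerre_freud {α β κ : ℝ} {b p c T : ℕ → ℝ}
    (hb : b 0 = 0) (hp0 : p 0 = 0) (hp : ∀ n, p (n + 1) = p n - b n)
    (hc : ∀ n : ℕ, c n = κ * (n - 2) * p n + (-(1 + κ)) * n - κ * n * p (n + 3))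
    (hT : ∀ n, T n = -2 * (1 + κ) - 2 * (α + β * κ)
      + κ * (2 * (α + β) + 4) * (b n + b (n + 1) + b (n + 2)))
    (hLF : ∀ n, 1 + (-(1 + κ)) * (b n + b (n + 1))
        + κ * (b n * b (n - 1) + (b n + b (n + 1)) ^ 2 + b (n + 1) * b (n + 2))
      + b (n + 1) * (2 * c n + T n) - b n * (2 * c (n - 1) + T (n - 1)) = 0) (n : ℕ) :
    0 = κ * p n ^ 2
      + (2 * κ * (α + β + n - 1 / 2) * b n - α * κ - β) * p n
      - κ * (α + β + n + 3 / 2) * (α + β + n - 1 / 2) * b n ^ 2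
      - (κ * (α + β + n + 3 / 2) * (α + β + n - 1 / 2) * b (n + 1)
          - ((β + n + 1 / 2) * κ + (α + n + 1 / 2)) * (α + β + n - 1 / 2)
          + κ * (α + β + n + 1 / 2) * (α + β + n - 3 / 2) * b (n - 1)) * b n
      - (n : ℝ) / 2 * ((n : ℝ) / 2 + α + β) := by
  induction n with
  | zero => simp [hb, hp0]
  | succ n ih =>
    -- Every `p` is reduced to a single index; what remains is `E_{n+1} - E_n` as a multiple of
    -- `F_n`.
    have h := hLF n
    rw [hc, hc, hT, hT, hp (n + 2), hp (n + 1), hp n] at h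
    rw [hp n, Nat.add_sub_cancel]
    push_cast
    cases n with
    | zero =>
      simp only [hb, hp0, Nat.cast_zero, zero_mul, sub_zero] at h ⊢
      linear_combination (α + β + 1 / 2) / 2 * h
    | succ n =>
      simp only [Nat.add_sub_cancel, hp (n + 2), hp (n + 1), hp n] at h ih ⊢
      push_cast at h ih ⊢
      linear_combination ih + (α + β + n + 1 + 1 / 2) / 2 * h

/-! ### The weight: integrability, positivity and the Pearson equation. -/

theorem one_sub_sq_rpow_intervalIntegrable {α : ℝ} (hα : -1 < α) :
    IntervalIntegrable (fun x : ℝ => (1 - x ^ 2) ^ α) MeasureTheory.volume (-1) 1 := by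
  -- On `[-1, 0]` only the factor `(x + 1)^α` can be singular; reflection gives the other half.
  have hleft : IntervalIntegrable (fun x : ℝ => (1 - x ^ 2) ^ α) MeasureTheory.volume (-1) 0 := by
    have h1 := (intervalIntegral.intervalIntegrable_rpow' (a := 0) (b := 1) hα).comp_add_right 1
    rw [zero_sub, sub_self] at h1
    have h2 : ContinuousOn (fun x : ℝ => (1 - x) ^ α) (Set.uIcc (-1) 0) := by
      refine ContinuousOn.rpow_const (by fun_prop) fun x hx => Or.inl ?_
      rw [Set.uIcc_of_le (by norm_num)] at hx
      linarith [hx.2]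
    refine (h1.mul_continuousOn h2).congr fun x hx => ?_
    rw [Set.uIoc_of_le (by norm_num)] at hx
    change (x + 1) ^ α * (1 - x) ^ α = (1 - x ^ 2) ^ α
    rw [← Real.mul_rpow (by linarith [hx.1]) (by linarith [hx.2])]
    congr 1
    ring
  refine hleft.trans ?_
  have h := hleft.comp_sub_left 0
  simp only [zero_sub, neg_neg, even_two.neg_pow, neg_zero] at h
  exact h.symm

theorem one_sub_mul_sq_pos {k x : ℝ} (hk1 : k ^ 2 < 1) (hx : x ∈ Set.Icc (-1 : ℝ) 1) :
    0 < 1 - k ^ 2 * x ^ 2 := by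
  have : x ^ 2 ≤ 1 := by nlinarith [hx.1, hx.2]
  nlinarith [sq_nonneg k]

theorem one_sub_sq_pos {x : ℝ} (hx : x ∈ Set.Ioo (-1 : ℝ) 1) : 0 < 1 - x ^ 2 := by
  nlinarith [hx.1, hx.2]

theorem modJacobiWeight_pos {α β k x : ℝ} (hk1 : k ^ 2 < 1) (hx : x ∈ Set.Ioo (-1 : ℝ) 1) :
    0 < modJacobiWeight α β k x :=
  mul_pos (Real.rpow_pos_of_pos (one_sub_sq_pos hx) _)
    (Real.rpow_pos_of_pos (one_sub_mul_sq_pos hk1 (Set.Ioo_subset_Icc_self hx)) _)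

theorem modJacobiWeight_neg (α β k x : ℝ) :
    modJacobiWeight α β k (-x) = modJacobiWeight α β k x := by
  simp [modJacobiWeight]

theorem modJacobiWeight_intervalIntegrable {α k : ℝ} (β : ℝ) (hα : -1 < α) (hk1 : k ^ 2 < 1) :
    IntervalIntegrable (modJacobiWeight α β k) MeasureTheory.volume (-1) 1 := by
  refine (one_sub_sq_rpow_intervalIntegrable hα).mul_continuousOn ?_
  refine ContinuousOn.rpow_const (by fun_prop) fun x hx => Or.inl ?_
  rw [Set.uIcc_of_le (by norm_num)] at hx
  exact (one_sub_mul_sq_pos hk1 hx).ne'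

theorem eval_mul_intervalIntegrable {w : ℝ → ℝ}
    (hw : IntervalIntegrable w MeasureTheory.volume (-1) 1) (p : ℝ[X]) :
    IntervalIntegrable (fun x => p.eval x * w x) MeasureTheory.volume (-1) 1 :=
  hw.continuousOn_mul p.continuous.continuousOn

/-- Integration of polynomials against an integrable weight on `[-1, 1]`. -/
noncomputable def weightFunctional (w : ℝ → ℝ)
    (hw : IntervalIntegrable w MeasureTheory.volume (-1) 1) : ℝ[X] →ₗ[ℝ] ℝ where
  toFun p := ∫ x in (-1 : ℝ)..1, p.eval x * w x
  map_add' p q := by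
    rw [← intervalIntegral.integral_add (eval_mul_intervalIntegrable hw p)
      (eval_mul_intervalIntegrable hw q)]
    simp only [eval_add, add_mul]
  map_smul' c p := by
    rw [RingHom.id_apply, smul_eq_mul, ← intervalIntegral.integral_const_mul]
    simp only [eval_smul, smul_eq_mul, mul_assoc]

theorem weightFunctional_apply (w : ℝ → ℝ)
    (hw : IntervalIntegrable w MeasureTheory.volume (-1) 1) (p : ℝ[X]) :
    weightFunctional w hw p = ∫ x in (-1 : ℝ)..1, p.eval x * w x := rfl

theorem weightFunctional_mul (w : ℝ → ℝ)
    (hw : IntervalIntegrable w MeasureTheory.volume (-1) 1) (p q : ℝ[X]) :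
    weightFunctional w hw (p * q) = weightedInner w p q := by
  simp only [weightFunctional_apply, weightedInner, eval_mul]

theorem weightFunctional_isEvenPosDef {w : ℝ → ℝ}
    (hw : IntervalIntegrable w MeasureTheory.volume (-1) 1)
    (hpos : ∀ x ∈ Set.Ioo (-1 : ℝ) 1, 0 < w x) (heven : ∀ x, w (-x) = w x) :
    IsEvenPosDef (weightFunctional w hw) where
  pos p hp := by
    rw [weightFunctional_apply, intervalIntegral.integral_pos_iff_support_of_nonneg_ae' ?_
      (eval_mul_intervalIntegrable hw _)]
    · refine ⟨by norm_num, ?_⟩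
      have hsub : Set.Ioo (-1 : ℝ) 1 \ (p.roots.toFinset : Set ℝ) ⊆
          Function.support (fun x => (p * p).eval x * w x) ∩ Set.Ioc (-1) 1 := by
        rintro x ⟨hx, hroot⟩
        have hne : p.eval x ≠ 0 := by simpa [hp] using hroot
        refine ⟨?_, Set.Ioo_subset_Ioc_self hx⟩
        rw [Function.mem_support, eval_mul]
        exact mul_ne_zero (mul_ne_zero hne hne) (hpos x hx).ne'
      refine lt_of_lt_of_le ?_ (MeasureTheory.measure_mono hsub)
      rw [MeasureTheory.measure_sdiff_null (Set.Finite.measure_zero (Finset.finite_toSet _) _)]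
      simp
    · rw [Set.uIoc_of_le (by norm_num), Filter.EventuallyLE,
        MeasureTheory.ae_restrict_iff' measurableSet_Ioc]
      filter_upwards [MeasureTheory.Measure.ae_ne MeasureTheory.volume (1 : ℝ)] with x hx1 hx
      rw [eval_mul]
      exact mul_nonneg (mul_self_nonneg _) (hpos x ⟨hx.1, lt_of_le_of_ne hx.2 hx1⟩).le
  even p := by
    rw [weightFunctional_apply, weightFunctional_apply]
    have h := intervalIntegral.integral_comp_neg (a := -1) (b := 1) (fun x => p.eval x * w x)
    simpa [eval_comp, heven] using h

/-- The Pearson equation `(σ w)' = τ w` of the weight, in integrated form. -/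
theorem modJacobiWeight_pearson {α β k : ℝ} (hα : -1 < α) (hk1 : k ^ 2 < 1)
    (hw : IntervalIntegrable (modJacobiWeight α β k) MeasureTheory.volume (-1) 1) (f : ℝ[X]) :
    weightFunctional (modJacobiWeight α β k) hw
      ((1 + C (-(1 + k ^ 2)) * X ^ 2 + C (k ^ 2) * X ^ 4) * derivative f
        + (C (-2 * (1 + k ^ 2) - 2 * (α + β * k ^ 2)) * X
          + C (k ^ 2 * (2 * (α + β) + 4)) * X ^ 3) * f) = 0 := by
  rw [weightFunctional_apply]
  -- The primitive is `σ w f`. It may fail to be differentiable at `±1`, so continuity there and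
  -- derivatives inside are used.
  rw [intervalIntegral.integral_eq_sub_of_hasDerivAt_of_le
    (f := fun x => (1 - x ^ 2) ^ (α + 1) * (1 - k ^ 2 * x ^ 2) ^ (β + 1) * f.eval x)
    (by norm_num) ?_ ?_ (eval_mul_intervalIntegrable hw _)]
  · have : α + 1 ≠ 0 := by linarith
    simp [Real.zero_rpow this]
  · refine ContinuousOn.mul (ContinuousOn.mul ?_ ?_) f.continuous.continuousOn
    · exact ContinuousOn.rpow_const (by fun_prop) fun x _ => Or.inr (by linarith)
    · exact ContinuousOn.rpow_const (by fun_prop)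
        fun x hx => Or.inl (one_sub_mul_sq_pos hk1 hx).ne'
  · intro x hx
    have hu := (one_sub_sq_pos hx).ne'
    have hv := (one_sub_mul_sq_pos hk1 (Set.Ioo_subset_Icc_self hx)).ne'
    have h1 := (((hasDerivAt_id x).pow 2).const_sub 1).rpow_const (p := α + 1) (Or.inl hu)
    have h2 := ((((hasDerivAt_id x).pow 2).const_mul (k ^ 2)).const_sub 1).rpow_const
      (p := β + 1) (Or.inl hv)
    refine ((h1.mul h2).mul (f.hasDerivAt x)).congr_deriv ?_
    simp only [modJacobiWeight, id, Pi.pow_apply, Real.rpow_add_one hu, Real.rpow_add_one hv,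
      add_sub_cancel_right, Pi.mul_apply,
      eval_add, eval_mul, eval_pow, eval_C, eval_X, eval_one]
    push_cast
    ring

/-! ### Transfer to the stated definitions. -/

theorem isMonicOrthogonalSeq_iff (w : ℝ → ℝ)
    (hw : IntervalIntegrable w MeasureTheory.volume (-1) 1) (P : ℕ → ℝ[X]) :
    IsMonicOrthogonalSeq w P ↔ IsMonicOrthogonal (weightFunctional w hw) P := by
  constructor
  · intro h
    exact ⟨h.monic, h.natDegree_eq, fun i j hij => by
      rw [weightFunctional_mul]; exact h.orthogonal i j hij⟩
  · intro h
    exact ⟨h.monic, h.natDegree_eq, fun i j hij => by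
      rw [← weightFunctional_mul w hw]; exact h.orthogonal i j hij⟩

theorem IsMonicOrthogonal.isSymmRecurrence {w : ℝ → ℝ}
    {hw : IntervalIntegrable w MeasureTheory.volume (-1) 1}
    (hL : IsEvenPosDef (weightFunctional w hw)) {P : ℕ → ℝ[X]}
    (hP : IsMonicOrthogonal (weightFunctional w hw) P) :
    IsSymmRecurrence (weightFunctional w hw) P (recCoeff w P) := by
  have hsq (n : ℕ) : weightFunctional w hw (P (n + 1) * P (n + 1)) =
      recCoeff w P (n + 1) * weightFunctional w hw (P n * P n) := by
    have h := (hP.pos hL n).ne'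
    rw [weightFunctional_mul] at h
    rw [weightFunctional_mul, weightFunctional_mul]
    exact (div_mul_cancel₀ _ h).symm
  exact { hP with zero := rfl, sqNorm_succ := hsq, X_mul := hP.X_mul hL rfl hsq }

/-- The polynomials exist and are unique; `b` are their recurrence coefficients and `p₁` their
sub-leading coefficients. For `n = 0` the term `b (n - 1)` is multiplied by `b 0 = 0`, so the value
given to it by the truncated subtraction is immaterial. -/
theorem mainTheorem1 (α β k : ℝ) (hα : -1 < α) (hk0 : 0 < k ^ 2) (hk1 : k ^ 2 < 1) :
    (∃! P : ℕ → ℝ[X], IsMonicOrthogonalSeq (modJacobiWeight α β k) P) ∧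
    ∀ P : ℕ → ℝ[X], IsMonicOrthogonalSeq (modJacobiWeight α β k) P →
      ∀ b p₁ : ℕ → ℝ, b = recCoeff (modJacobiWeight α β k) P → p₁ = subleadingCoeff P →
        (X * P 0 = P 1 ∧
          ∀ n : ℕ, X * P (n + 1) = P (n + 2) + C (b (n + 1)) * P n) ∧
        ∀ n : ℕ,
          0 = k ^ 2 * p₁ n ^ 2
            + (2 * k ^ 2 * (α + β + n - 1 / 2) * b n - α * k ^ 2 - β) * p₁ n
            - k ^ 2 * (α + β + n + 3 / 2) * (α + β + n - 1 / 2) * b n ^ 2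
            - (k ^ 2 * (α + β + n + 3 / 2) * (α + β + n - 1 / 2) * b (n + 1)
                - ((β + n + 1 / 2) * k ^ 2 + (α + n + 1 / 2)) * (α + β + n - 1 / 2)
                + k ^ 2 * (α + β + n + 1 / 2) * (α + β + n - 3 / 2) * b (n - 1)) * b n
            - (n : ℝ) / 2 * ((n : ℝ) / 2 + α + β) := by
  have hw := modJacobiWeight_intervalIntegrable β hα hk1
  have hL : IsEvenPosDef (weightFunctional (modJacobiWeight α β k) hw) :=
    weightFunctional_isEvenPosDef hw (fun _ => modJacobiWeight_pos hk1)
      (modJacobiWeight_neg α β k)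
  constructor
  · obtain ⟨P, hP⟩ := hL.exists_isMonicOrthogonal
    exact ⟨P, (isMonicOrthogonalSeq_iff _ hw P).2 hP,
      fun Q hQ => hP.unique hL ((isMonicOrthogonalSeq_iff _ hw Q).1 hQ)⟩
  rintro P hP b p₁ rfl rfl
  have hP' := (isMonicOrthogonalSeq_iff _ hw P).1 hP
  have h := hP'.isSymmRecurrence hL
  refine ⟨⟨by simpa [h.zero] using h.X_mul 0, fun n => h.X_mul (n + 1)⟩, ?_⟩
  exact difference_equation_of_laguerre_freud rfl rfl h.subleadingCoeff_succ
    (fun _ => rfl) (fun _ => rfl)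
    (h.laguerre_freud (fun n => (hP'.pos hL n).ne') (modJacobiWeight_pearson hα hk1 hw)
      (fun _ => rfl) (fun _ => rfl))
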